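/- **Polynomial Hales–Jewett theorem.** For all positive integers $r, d, q$ there exists a positive integer $N = N(r,d,q)$ such that, with $V = \{1,\dots,N\}^d \times \{1,\dots,q\}$, the following holds: for every $r$-coloring of the set of all subsets of $V$, i.e. every map $\chi$ from the set of all subsets of $V$ (including $\emptyset$) to $\{1,\dots,r\}$, there exist a set $a \subseteq V$ and a nonempty set $\gamma \subseteq \{1,\dots,N\}$ such that $a \cap (\gamma^d \times \{1,\dots,q\}) = \emptyset$ and the sets $$a,\quad a \cup (\gamma^d \times \{1\}),\quad a \cup (\gamma^d \times \{2\}),\quad \dots,\quad a \cup (\gamma^d \times \{q\})$$ all have the same color, i.e. $\chi(a \cup (\gamma^d \times \{i\})) = \chi(a)$ for every $i \in \{1,\dots,q\}$. Here $\gamma^d \subseteq \{1,\dots,N\}^d$ is the $d$-fold Cartesian power of $\gamma$. -/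

import Mathlib

/-- The ground set `V = {1, …, N}^d × {1, …, q}`, with `Fin n` as the `n`-element index set. -/
abbrev PHJSpace (N d q : ℕ) : Type := (Fin d → Fin N) × Fin q

/-- The Cartesian power `γ^d ⊆ {1, …, N}^d` of a set `γ ⊆ {1, …, N}`. -/
def cartesianPower {N : ℕ} (d : ℕ) (γ : Finset (Fin N)) : Finset (Fin d → Fin N) :=
  Fintype.piFinset fun _ => γ

/-!
Color focusing, with termination by polynomial exhaustion as in Walters' proof.

Allow layers of different dimensions: a label `k` carries the cube `γ ^ C k`, and a label set `L`
carries the union of the cubes of its members. We want `a` and `γ` such that the color of `a`, with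
its trace on all the cubes replaced by the cubes of `L`, is the same for every `L` in a family `𝓛`.
Fix a base label set `B`. Focusing produces configurations which all take the same value at
`L = B`, each having a single color on `𝓛 \ {B}`, these colors being distinct. As soon as the
common value at `B` has one of these colors, the corresponding configuration is monochromatic, and
there cannot be more configurations than colors.

A further configuration is gained by enlarging the ground set `ι₁` to `ι₁ ⊕ ι₂`. A point with some
coordinate in `ι₂` is a point over `ι₂` of a label whose other coordinates have been evaluated in
`ι₁`. Passing from `γ₁` to `γ₁ ∪ γ₂` changes these points by a cube over `ι₂` whose layers are
those of `L` where the evaluated coordinates lie in `γ₁`, and those of `B` elsewhere. Hence it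
suffices to solve the problem over `ι₂` for all these label sets at once. Take as new base the one
coming from a `c ∈ 𝓛` whose top-degree difference from `B` has the least degree `m`. Evaluating a
coordinate lowers the degree, so the parts of degree `e ≥ m` in which the new label sets first
differ from the new base come from those of `𝓛`, while the part of `c` is lost.
-/

universe u

namespace PolyHalesJewett

open Set

section Point

variable {K ι : Type*} {C : K → Type*}

/-- Points over the ground set `ι`: a label `k` with an `ι`-valued tuple indexed by the
coordinates `C k` of `k`. With labels `Fin q` and coordinates `Fin d`, this is `ι^d × {1, …, q}`. -/
abbrev Point (C : K → Type*) (ι : Type*) : Type _ := Σ k : K, C k → ι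

/-- The map on points induced by a map of ground sets. -/
def Point.map {ι' : Type*} (φ : ι' → ι) (v : Point C ι') : Point C ι := ⟨v.1, φ ∘ v.2⟩

/-- The union `⋃ k, γ ^ C k` of the Cartesian powers of `γ`, one for each label. -/
def cube (C : K → Type*) (γ : Set ι) : Set (Point C ι) := {v | ∀ c, v.2 c ∈ γ}

/-- The set `a` with its trace on `⋃ k, γ ^ C k` replaced by `⋃ k ∈ L, γ ^ C k`. Overriding the
trace makes a disjointness condition between `a` and the cube unnecessary. -/
def override (a : Set (Point C ι)) (γ : Set ι) (L : Set K) : Set (Point C ι) :=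
  (cube C γ).ite (Sigma.fst ⁻¹' L) a

theorem mem_override {a : Set (Point C ι)} {γ : Set ι} {L : Set K} {v : Point C ι} :
    v ∈ override a γ L ↔ v ∈ cube C γ ∧ v.1 ∈ L ∨ v ∈ a ∧ v ∉ cube C γ :=
  or_congr_left and_comm

variable [∀ k, Nonempty (C k)]

theorem cube_empty : cube C (∅ : Set ι) = ∅ := by
  simp [cube]

theorem override_empty (a : Set (Point C ι)) (L : Set K) : override a ∅ L = a := by
  rw [override, cube_empty, ite_empty]

end Point

section PartialLabel

variable {K ι : Type*} {C : K → Type*}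

/-- Labels whose coordinates are partially evaluated in `ι`, at least one remaining free. -/
abbrev PartialLabel (C : K → Type*) (ι : Type*) : Type _ :=
  Σ k : K, {z : C k → Option ι // ∃ c, z c = none}

/-- The free coordinates of a partially evaluated label. -/
abbrev FreeCoord (C : K → Type*) (ι : Type*) (k : PartialLabel C ι) : Type _ :=
  {c : C k.1 // k.2.1 c = none}

instance nonempty_freeCoord (k : PartialLabel C ι) : Nonempty (FreeCoord C ι k) :=
  nonempty_subtype.2 k.2.2

/-- The partially evaluated labels all of whose evaluated coordinates lie in `δ`. -/
def evaluatedIn (C : K → Type*) (δ : Set ι) : Set (PartialLabel C ι) :=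
  {k | ∀ c u, k.2.1 c = some u → u ∈ δ}

/-- The set of partially evaluated labels which agrees with `L` on those evaluated in `δ`, and with
`B` elsewhere. -/
def liftLabels (C : K → Type*) (B L : Set K) (δ : Set ι) : Set (PartialLabel C ι) :=
  (evaluatedIn C δ).ite (Sigma.fst ⁻¹' L) (Sigma.fst ⁻¹' B)

theorem liftLabels_self (B : Set K) (δ : Set ι) : liftLabels C B B δ = Sigma.fst ⁻¹' B :=
  ite_same _ _

end PartialLabel

section Combine

variable {K ι₁ ι₂ : Type*} {C : K → Type*}

open Classical in
/-- A point over `ι₁ ⊕ ι₂` is either a point over `ι₁`, or, evaluating the coordinates in `ι₁`, a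
point over `ι₂` with a partially evaluated label. -/
noncomputable def Point.split (v : Point C (ι₁ ⊕ ι₂)) :
    Point C ι₁ ⊕ Point (FreeCoord C ι₁) ι₂ :=
  if h : ∃ c, (v.2 c).getLeft? = none then
    .inr ⟨⟨v.1, fun c => (v.2 c).getLeft?, h⟩,
      fun c => (v.2 c.1).getRight (Sum.getLeft?_eq_none_iff.1 c.2)⟩
  else
    .inl ⟨v.1, fun c => (v.2 c).getLeft (by simpa using not_exists.1 h c)⟩

/-- The set of points over `ι₁ ⊕ ι₂` whose points over `ι₁` are `x`, and whose remaining points,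
seen as points over `ι₂`, are `y`. -/
def combine (x : Set (Point C ι₁)) (y : Set (Point (FreeCoord C ι₁) ι₂)) :
    Set (Point C (ι₁ ⊕ ι₂)) :=
  Point.split ⁻¹' (Sum.inl '' x ∪ Sum.inr '' y)

theorem mem_combine_of_split_eq_inl {x : Set (Point C ι₁)} {y : Set (Point (FreeCoord C ι₁) ι₂)}
    {v : Point C (ι₁ ⊕ ι₂)} {w : Point C ι₁} (h : v.split = .inl w) : v ∈ combine x y ↔ w ∈ x := by
  simp [combine, h]

theorem mem_combine_of_split_eq_inr {x : Set (Point C ι₁)} {y : Set (Point (FreeCoord C ι₁) ι₂)}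
    {v : Point C (ι₁ ⊕ ι₂)} {w : Point (FreeCoord C ι₁) ι₂} (h : v.split = .inr w) :
    v ∈ combine x y ↔ w ∈ y := by
  simp [combine, h]

theorem combine_ite_combine (s x x' : Set (Point C ι₁)) (t y y' : Set (Point (FreeCoord C ι₁) ι₂)) :
    (combine s t).ite (combine x y) (combine x' y') = combine (s.ite x x') (t.ite y y') := by
  ext v
  rcases h : v.split with w | w <;> simp [combine, Set.ite, h]

theorem combine_fst_preimage (L : Set K) :
    combine (Sigma.fst ⁻¹' L) (Sigma.fst ⁻¹' (Sigma.fst ⁻¹' L)) =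
      (Sigma.fst ⁻¹' L : Set (Point C (ι₁ ⊕ ι₂))) := by
  ext v
  by_cases h : ∃ c, (v.2 c).getLeft? = none
  · exact mem_combine_of_split_eq_inr (dif_pos h)
  · exact mem_combine_of_split_eq_inl (dif_neg h)

theorem mem_inl_image_union_inr_image {γ₁ : Set ι₁} {γ₂ : Set ι₂} {s : ι₁ ⊕ ι₂} :
    s ∈ Sum.inl '' γ₁ ∪ Sum.inr '' γ₂ ↔
      (∀ h : s.getLeft? = none, s.getRight (Sum.getLeft?_eq_none_iff.1 h) ∈ γ₂) ∧
        ∀ u, s.getLeft? = some u → u ∈ γ₁ := by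
  cases s <;> simp

theorem cube_inl_union_inr (γ₁ : Set ι₁) (γ₂ : Set ι₂) :
    cube C (Sum.inl '' γ₁ ∪ Sum.inr '' γ₂) =
      combine (cube C γ₁) (cube (FreeCoord C ι₁) γ₂ ∩ Sigma.fst ⁻¹' evaluatedIn C γ₁) := by
  ext v
  by_cases h : ∃ c, (v.2 c).getLeft? = none
  · rw [mem_combine_of_split_eq_inr (v := v) (dif_pos h)]
    refine (forall_congr' fun c => mem_inl_image_union_inr_image).trans (forall_and.trans ?_)
    exact and_congr_left' ⟨fun H c => H c.1 c.2, fun H c hc => H ⟨c, hc⟩⟩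
  · rw [mem_combine_of_split_eq_inl (v := v) (dif_neg h)]
    refine forall_congr' fun c => ?_
    obtain ⟨u, hu⟩ := Option.ne_none_iff_exists'.1 (not_exists.1 h c)
    simp [Sum.getLeft?_eq_some_iff.1 hu]

theorem cube_image_inl (γ : Set ι₁) :
    cube C (Sum.inl '' γ : Set (ι₁ ⊕ ι₂)) = combine (cube C γ) ∅ := by
  simpa [cube_empty] using cube_inl_union_inr (C := C) γ (∅ : Set ι₂)

theorem override_combine_inl (x : Set (Point C ι₁)) (y : Set (Point (FreeCoord C ι₁) ι₂))
    (γ : Set ι₁) (L : Set K) :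
    override (combine x y) (Sum.inl '' γ) L = combine (override x γ L) y := by
  rw [override, cube_image_inl, ← combine_fst_preimage, combine_ite_combine, ite_empty, override]

theorem inter_ite_ite {α : Type*} (s t u v w : Set α) :
    (s ∩ t).ite u (s.ite v w) = s.ite (t.ite u v) w := by
  ext
  simp only [Set.ite, mem_union, mem_inter_iff, mem_sdiff]
  tauto

theorem override_combine_union (x : Set (Point C ι₁)) (y : Set (Point (FreeCoord C ι₁) ι₂))
    (γ₁ : Set ι₁) (γ₂ : Set ι₂) (B L : Set K) :
    override (combine x (override y γ₂ (Sigma.fst ⁻¹' B))) (Sum.inl '' γ₁ ∪ Sum.inr '' γ₂) L =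
      combine (override x γ₁ L) (override y γ₂ (liftLabels C B L γ₁)) := by
  rw [override, cube_inl_union_inr, ← combine_fst_preimage, combine_ite_combine, override,
    inter_ite_ite]
  rfl

end Combine

section Focusing

variable {K ι ι' ι₁ ι₂ κ : Type*} {C : K → Type*}

/-- Some `a` and some nonempty `γ` make `χ` constant on `{override a γ L | L ∈ 𝓛}`. -/
def HasMonochromatic (𝓛 : Set (Set K)) (χ : Set (Point C ι) → κ) : Prop :=
  ∃ (a : Set (Point C ι)) (γ : Set ι), γ.Nonempty ∧
    ∀ L ∈ 𝓛, ∀ L' ∈ 𝓛, χ (override a γ L) = χ (override a γ L')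

/-- The configuration `override a γ` is a spoke of color `t` with focus `f`: it takes the value `f`
at the base `B`, and has color `t` on the rest of `𝓛`. -/
structure IsSpoke (𝓛 : Set (Set K)) (B : Set K) (χ : Set (Point C ι) → κ) (f : Set (Point C ι))
    (t : κ) (a : Set (Point C ι)) (γ : Set ι) : Prop where
  focus : override a γ B = f
  color : ∀ L ∈ 𝓛, L ≠ B → χ (override a γ L) = t

/-- There are `n` spokes with pairwise distinct colors and a common focus. -/
def IsColorFocused (𝓛 : Set (Set K)) (B : Set K) (χ : Set (Point C ι) → κ) (n : ℕ) : Prop :=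
  ∃ (f : Set (Point C ι)) (T : Finset κ), T.card = n ∧
    ∀ t ∈ T, ∃ a γ, γ.Nonempty ∧ IsSpoke 𝓛 B χ f t a γ

/-- The label sets over the second summand that arise when extending the spokes for `𝓛` with base
`B` from the ground set `ι` to a sum. -/
def focusFamily (C : K → Type*) (𝓛 : Set (Set K)) (B : Set K) (ι : Type*) :
    Set (Set (PartialLabel C ι)) :=
  image2 (liftLabels C B) (𝓛 \ {B}) univ

variable {𝓛 : Set (Set K)} {B : Set K}

theorem isColorFocused_zero (𝓛 : Set (Set K)) (B : Set K) (χ : Set (Point C ι) → κ) :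
    IsColorFocused 𝓛 B χ 0 :=
  ⟨∅, ∅, rfl, by simp⟩

theorem IsColorFocused.le_card [Finite κ] {χ : Set (Point C ι) → κ} {n : ℕ}
    (h : IsColorFocused 𝓛 B χ n) : n ≤ Nat.card κ := by
  obtain ⟨-, T, rfl, -⟩ := h
  have := Fintype.ofFinite κ
  exact Nat.card_eq_fintype_card (α := κ) ▸ T.card_le_univ

theorem isSpoke_empty [∀ k, Nonempty (C k)] (χ : Set (Point C ι) → κ) (f : Set (Point C ι)) :
    IsSpoke 𝓛 B χ f (χ f) f ∅ :=
  ⟨override_empty f B, fun L _ _ => by rw [override_empty]⟩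

theorem IsSpoke.hasMonochromatic {χ : Set (Point C ι) → κ} {f a : Set (Point C ι)} {γ : Set ι}
    (h : IsSpoke 𝓛 B χ f (χ f) a γ) (hγ : γ.Nonempty) : HasMonochromatic 𝓛 χ := by
  have hf : ∀ L ∈ 𝓛, χ (override a γ L) = χ f := fun L hL => by
    by_cases hLB : L = B
    · rw [hLB, h.focus]
    · exact h.color L hL hLB
  exact ⟨a, γ, hγ, fun L hL L' hL' => (hf L hL).trans (hf L' hL').symm⟩

theorem HasMonochromatic.of_surjective {φ : ι' → ι} (hφ : φ.Surjective)
    {χ : Set (Point C ι') → κ}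
    (h : HasMonochromatic 𝓛 fun A : Set (Point C ι) => χ (Point.map φ ⁻¹' A)) :
    HasMonochromatic 𝓛 χ := by
  obtain ⟨a, γ, hγ, ha⟩ := h
  exact ⟨Point.map φ ⁻¹' a, φ ⁻¹' γ, hγ.preimage hφ, ha⟩

theorem HasMonochromatic.of_combine {χ : Set (Point C (ι₁ ⊕ ι₂)) → κ}
    {y : Set (Point (FreeCoord C ι₁) ι₂)} (h : HasMonochromatic 𝓛 fun x => χ (combine x y)) :
    HasMonochromatic 𝓛 χ := by
  obtain ⟨a, γ, hγ, ha⟩ := h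
  exact ⟨combine a y, Sum.inl '' γ, hγ.image _, by simpa only [override_combine_inl] using ha⟩

section Extend

variable {χ : Set (Point C (ι₁ ⊕ ι₂)) → κ} {y y₀ : Set (Point (FreeCoord C ι₁) ι₂)} {γ : Set ι₂}
  (hχ : ∀ M ∈ focusFamily C 𝓛 B ι₁, ∀ x, χ (combine x (override y γ M)) = χ (combine x y₀))

include hχ

theorem IsSpoke.extend {f a : Set (Point C ι₁)} {t : κ} {γ₁ : Set ι₁}
    (h : IsSpoke 𝓛 B (fun x => χ (combine x y₀)) f t a γ₁) :
    IsSpoke 𝓛 B χ (combine f (override y γ (Sigma.fst ⁻¹' B))) t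
      (combine a (override y γ (Sigma.fst ⁻¹' B))) (Sum.inl '' γ₁ ∪ Sum.inr '' γ) where
  focus := by rw [override_combine_union, liftLabels_self, h.focus]
  color L hL hLB := by
    rw [override_combine_union, hχ _ (mem_image2_of_mem ⟨hL, hLB⟩ (mem_univ _)), h.color L hL hLB]

theorem IsColorFocused.extend [∀ k, Nonempty (C k)] (hγ : γ.Nonempty) {n : ℕ}
    (h : IsColorFocused 𝓛 B (fun x => χ (combine x y₀)) n) :
    HasMonochromatic 𝓛 χ ∨ IsColorFocused 𝓛 B χ (n + 1) := by
  classical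
  obtain ⟨f, T, hT, hf⟩ := h
  by_cases hfT : χ (combine f y₀) ∈ T
  · obtain ⟨a, γ₁, hγ₁, ha⟩ := hf _ hfT
    exact .inl (ha.hasMonochromatic hγ₁).of_combine
  have hspoke : ∀ t ∈ insert (χ (combine f y₀)) T, ∃ a γ₁,
      IsSpoke 𝓛 B (fun x => χ (combine x y₀)) f t a γ₁ := by
    intro t ht
    rcases Finset.mem_insert.1 ht with rfl | ht
    · exact ⟨f, ∅, isSpoke_empty _ f⟩
    · obtain ⟨a, γ₁, -, ha⟩ := hf t ht
      exact ⟨a, γ₁, ha⟩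
  refine .inr ⟨combine f (override y γ (Sigma.fst ⁻¹' B)), insert (χ (combine f y₀)) T,
    by rw [Finset.card_insert_of_notMem hfT, hT], fun t ht => ?_⟩
  obtain ⟨a, γ₁, ha⟩ := hspoke t ht
  exact ⟨_, _, (hγ.image _).inr, ha.extend hχ⟩

end Extend

end Focusing

/-- For every finite number of colors there is a finite ground set `ι` over which every coloring
has a monochromatic configuration for `𝓛`. -/
def IsRamsey {K : Type u} (C : K → Type u) (𝓛 : Set (Set K)) : Prop :=
  ∀ (κ : Type u) [Finite κ], ∃ (ι : Type u) (_ : Finite ι) (_ : Nonempty ι),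
    ∀ χ : Set (Point C ι) → κ, HasMonochromatic 𝓛 χ

theorem IsRamsey.exists_fin {K : Type u} {C : K → Type u} {𝓛 : Set (Set K)} (h : IsRamsey C 𝓛)
    (κ : Type u) [Finite κ] :
    ∃ N : ℕ, 1 ≤ N ∧ ∀ χ : Set (Point C (Fin N)) → κ, HasMonochromatic 𝓛 χ := by
  obtain ⟨ι, _, _, hι⟩ := h κ
  exact ⟨Nat.card ι, Nat.card_pos,
    fun χ => (hι _).of_surjective (Finite.equivFin ι).symm.surjective⟩

section Ramsey

variable {K : Type u} {C : K → Type u} {𝓛 : Set (Set K)} {B : Set K}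

theorem isRamsey_of_subsingleton (h : 𝓛.Subsingleton) : IsRamsey C 𝓛 := fun _ _ =>
  ⟨PUnit, inferInstance, inferInstance, fun _ =>
    ⟨∅, univ, univ_nonempty, fun _ hL _ hL' => by rw [h hL hL']⟩⟩

variable [Finite K] [∀ k, Finite (C k)] [∀ k, Nonempty (C k)]

theorem exists_hasMonochromatic_or_isColorFocused (hne : (𝓛 \ {B}).Nonempty)
    (h : ∀ (ι : Type u) [Finite ι], IsRamsey (FreeCoord C ι) (focusFamily C 𝓛 B ι))
    (κ : Type u) [Finite κ] (n : ℕ) :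
    ∃ (ι : Type u) (_ : Finite ι) (_ : Nonempty ι), ∀ χ : Set (Point C ι) → κ,
      HasMonochromatic 𝓛 χ ∨ IsColorFocused 𝓛 B χ n := by
  obtain ⟨c, hc⟩ := hne
  induction n with
  | zero => exact ⟨PUnit, inferInstance, inferInstance, fun χ => .inr (isColorFocused_zero 𝓛 B χ)⟩
  | succ n ih =>
    obtain ⟨ι₁, _, _, h₁⟩ := ih
    -- Coloring `y` by the whole coloring `x ↦ χ (combine x y)` makes the choice of `y` below
    -- independent of `x`.
    obtain ⟨ι₂, _, _, h₂⟩ := h ι₁ (Set (Point C ι₁) → κ)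
    refine ⟨ι₁ ⊕ ι₂, inferInstance, inferInstance, fun χ => ?_⟩
    obtain ⟨y, γ, hγ, hy⟩ := h₂ fun y x => χ (combine x y)
    have hχ : ∀ M ∈ focusFamily C 𝓛 B ι₁, ∀ x, χ (combine x (override y γ M)) =
        χ (combine x (override y γ (liftLabels C B c ∅))) :=
      fun M hM => congrFun (hy M hM _ (mem_image2_of_mem hc (mem_univ ∅)))
    rcases h₁ fun x => χ (combine x (override y γ (liftLabels C B c ∅))) with hmono | hfocused
    · exact .inl hmono.of_combine
    · exact hfocused.extend hχ hγ

theorem isRamsey_of_focusFamily (hne : (𝓛 \ {B}).Nonempty)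
    (h : ∀ (ι : Type u) [Finite ι], IsRamsey (FreeCoord C ι) (focusFamily C 𝓛 B ι)) :
    IsRamsey C 𝓛 := by
  intro κ _
  obtain ⟨ι, hι, hι', H⟩ :=
    exists_hasMonochromatic_or_isColorFocused hne h κ (Nat.card κ + 1)
  exact ⟨ι, hι, hι', fun χ => (H χ).resolve_right fun hχ => hχ.le_card.not_gt (Nat.lt_succ_self _)⟩

end Ramsey

section Weight

variable {K ι : Type*} {C : K → Type*}

/-- The labels of `L` of degree `e`, the degree of a label being its number of coordinates. -/
def degreePart (C : K → Type*) (L : Set K) (e : ℕ) : Set K := {k ∈ L | Nat.card (C k) = e}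

/-- The largest degree in which `L` and `M` differ is `e`. -/
def IsDiffDegree (C : K → Type*) (L M : Set K) (e : ℕ) : Prop :=
  IsGreatest {e | degreePart C L e ≠ degreePart C M e} e

/-- The parts of degree `e` of those members of `𝓛` for which `e` is the largest degree in which
they differ from `B`. -/
def leadingParts (C : K → Type*) (𝓛 : Set (Set K)) (B : Set K) (e : ℕ) : Set (Set K) :=
  (degreePart C · e) '' {L ∈ 𝓛 | IsDiffDegree C L B e}

/-- The complexity of `𝓛` relative to `B`: the numbers of leading parts of the various degrees, of
which those of the higher degrees matter most. The induction runs along this quantity. -/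
noncomputable def weight (C : K → Type*) (d : ℕ) (𝓛 : Set (Set K)) (B : Set K) :
    Colex (Fin (d + 1) → ℕ) :=
  toColex fun e => (leadingParts C 𝓛 B e).ncard

theorem toColex_lt_toColex_of_le_of_lt {α β : Type*} [LinearOrder α] [WellFoundedGT α]
    [PartialOrder β] {f g : α → β} {m : α} (hle : ∀ e, m < e → f e ≤ g e) (hlt : f m < g m) :
    toColex f < toColex g :=
  calc toColex f ≤ toColex fun e => if m < e then g e else f e :=
        Pi.toColex_monotone fun e => by
          split_ifs with h
          exacts [hle e h, le_rfl]
    _ < toColex g := ⟨m, fun e he => if_pos he, by simpa using hlt⟩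

variable {L M B c : Set K} {e m : ℕ} {δ δ' : Set ι}

theorem mem_iff_of_degreePart_eq {k : K}
    (h : degreePart C L (Nat.card (C k)) = degreePart C M (Nat.card (C k))) : k ∈ L ↔ k ∈ M := by
  simpa [degreePart] using Set.ext_iff.1 h k

theorem IsDiffDegree.degreePart_eq (h : IsDiffDegree C L M m) (he : m < e) :
    degreePart C L e = degreePart C M e :=
  not_not.1 fun hne => (h.2 hne).not_gt he

theorem exists_card_eq_of_degreePart_ne (h : degreePart C L e ≠ degreePart C M e) :
    ∃ k, Nat.card (C k) = e := by
  by_contra! hne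
  exact h (by simp [degreePart, hne])

theorem exists_isDiffDegree [Finite K] (h : L ≠ M) : ∃ e, IsDiffDegree C L M e := by
  have hne : {e | degreePart C L e ≠ degreePart C M e}.Nonempty := by
    by_contra hempty
    refine h (Set.ext fun k => mem_iff_of_degreePart_eq (C := C) (not_not.1 fun hk => ?_))
    exact hempty ⟨_, hk⟩
  have hbdd : BddAbove {e | degreePart C L e ≠ degreePart C M e} :=
    ((finite_range fun k => Nat.card (C k)).subset fun _ he =>
      exists_card_eq_of_degreePart_ne he).bddAbove
  exact ⟨_, Nat.sSup_mem hne hbdd, fun _ => le_csSup hbdd⟩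

theorem exists_isDiffDegree_minimal [Finite K] {𝓛 : Set (Set K)} (h : (𝓛 \ {B}).Nonempty) :
    ∃ c ∈ 𝓛, ∃ m, IsDiffDegree C c B m ∧ ∀ L ∈ 𝓛, ∀ e, IsDiffDegree C L B e → m ≤ e := by
  have hne : {e | ∃ L ∈ 𝓛, IsDiffDegree C L B e}.Nonempty := by
    obtain ⟨L, hL, hLB⟩ := h
    obtain ⟨e, he⟩ := exists_isDiffDegree (C := C) hLB
    exact ⟨e, L, hL, he⟩
  obtain ⟨c, hc, hcm⟩ := Nat.sInf_mem hne
  exact ⟨c, hc, _, hcm, fun L hL e he => Nat.sInf_le ⟨L, hL, he⟩⟩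

theorem mem_liftLabels_of_mem_iff {k : PartialLabel C ι} (h : k.1 ∈ L ↔ k.1 ∈ B) :
    k ∈ liftLabels C B L δ ↔ k.1 ∈ B := by
  simp only [liftLabels, Set.ite, mem_union, mem_inter_iff, mem_sdiff, mem_preimage]
  tauto

theorem mem_liftLabels_of_forall_eq_none {k : PartialLabel C ι} (h : ∀ c, k.2.1 c = none) :
    k ∈ liftLabels C B L δ ↔ k.1 ∈ L := by
  simp [liftLabels, evaluatedIn, Set.ite, h]

theorem mem_liftLabels_empty_of_not_forall_eq_none {k : PartialLabel C ι}
    (h : ¬ ∀ c, k.2.1 c = none) : k ∈ liftLabels C B L ∅ ↔ k.1 ∈ B := by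
  have hk : k ∉ evaluatedIn C ∅ := fun hk =>
    h fun c => Option.eq_none_iff_forall_ne_some.2 fun u hu => hk c u hu
  simp [liftLabels, Set.ite, hk]

theorem degreePart_eq_of_degreePart_liftLabels_eq [∀ k, Nonempty (C k)]
    (h : degreePart (FreeCoord C ι) (liftLabels C B L δ) e =
      degreePart (FreeCoord C ι) (liftLabels C B M δ') e) :
    degreePart C L e = degreePart C M e := by
  ext k
  let free : PartialLabel C ι := ⟨k, fun _ => none, Classical.arbitrary _, rfl⟩
  have hcard : Nat.card (FreeCoord C ι free) = Nat.card (C k) :=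
    Nat.card_congr (Equiv.subtypeUnivEquiv fun _ => rfl)
  have hfree := Set.ext_iff.1 h free
  simpa only [degreePart, mem_sep_iff, hcard,
    mem_liftLabels_of_forall_eq_none (k := free) fun _ => rfl] using hfree

theorem card_freeCoord_lt [∀ k, Finite (C k)] {k : PartialLabel C ι}
    (h : ¬ ∀ c, k.2.1 c = none) : Nat.card (FreeCoord C ι k) < Nat.card (C k.1) := by
  obtain ⟨c, hc⟩ := not_forall.1 h
  exact Finite.card_subtype_lt hc

theorem degreePart_liftLabels [∀ k, Finite (C k)]
    (hL : ∀ e' > e, degreePart C L e' = degreePart C B e') :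
    degreePart (FreeCoord C ι) (liftLabels C B L δ) e =
      degreePart (FreeCoord C ι) (liftLabels C B (degreePart C L e) ∅) e := by
  ext k
  refine and_congr_left fun hk => ?_
  by_cases hfree : ∀ c, k.2.1 c = none
  · have hcard : Nat.card (C k.1) = e :=
      (Nat.card_congr (Equiv.subtypeUnivEquiv hfree)).symm.trans hk
    rw [mem_liftLabels_of_forall_eq_none hfree, mem_liftLabels_of_forall_eq_none hfree]
    exact (and_iff_left hcard).symm
  · have hcard : Nat.card (C k.1) > e := hk ▸ card_freeCoord_lt hfree
    rw [mem_liftLabels_of_mem_iff (mem_iff_of_degreePart_eq (hL _ hcard)),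
      mem_liftLabels_empty_of_not_forall_eq_none hfree]

theorem degreePart_liftLabels_congr [∀ k, Finite (C k)]
    (hL : ∀ e' > e, degreePart C L e' = degreePart C B e')
    (hM : ∀ e' > e, degreePart C M e' = degreePart C B e')
    (h : degreePart C L e = degreePart C M e) :
    degreePart (FreeCoord C ι) (liftLabels C B L δ) e =
      degreePart (FreeCoord C ι) (liftLabels C B M δ') e := by
  rw [degreePart_liftLabels hL, degreePart_liftLabels hM, h]

variable [∀ k, Finite (C k)] [∀ k, Nonempty (C k)]

theorem IsDiffDegree.of_liftLabels {e' : ℕ} (hc : IsDiffDegree C c B m) (hL : IsDiffDegree C L B e')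
    (hme : m ≤ e) (hme' : m ≤ e')
    (h : IsDiffDegree (FreeCoord C ι) (liftLabels C B L δ) (liftLabels C B c δ') e) :
    e' = e := by
  refine le_antisymm (not_lt.1 fun hlt => hL.1 ?_) (not_lt.1 fun hlt => h.1 ?_)
  · rw [degreePart_eq_of_degreePart_liftLabels_eq (h.degreePart_eq hlt),
      hc.degreePart_eq (hme.trans_lt hlt)]
  · refine degreePart_liftLabels_congr (fun _ he => hL.degreePart_eq (hlt.trans he))
      (fun _ he => hc.degreePart_eq (hme.trans_lt he)) ?_
    rw [hL.degreePart_eq hlt, hc.degreePart_eq (hme'.trans_lt hlt)]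

variable {𝓛 : Set (Set K)}

theorem leadingParts_focusFamily_subset [Finite K] (hc : IsDiffDegree C c B m)
    (hmin : ∀ L ∈ 𝓛, ∀ e, IsDiffDegree C L B e → m ≤ e) (hme : m ≤ e) :
    leadingParts (FreeCoord C ι) (focusFamily C 𝓛 B ι) (liftLabels C B c ∅) e ⊆
      (fun A => degreePart (FreeCoord C ι) (liftLabels C B A ∅) e) ''
        (leadingParts C 𝓛 B e \ {degreePart C c e}) := by
  rintro _ ⟨_, ⟨⟨L, ⟨hL, hLB⟩, δ, -, rfl⟩, hdiff⟩, rfl⟩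
  obtain ⟨e', hLe⟩ := exists_isDiffDegree (C := C) hLB
  obtain rfl : e' = e := hc.of_liftLabels hLe hme (hmin L hL e' hLe) hdiff
  refine ⟨degreePart C L e', ⟨⟨L, ⟨hL, hLe⟩, rfl⟩, fun hLc => hdiff.1 ?_⟩,
    (degreePart_liftLabels fun _ he => hLe.degreePart_eq he).symm⟩
  exact degreePart_liftLabels_congr (fun _ he => hLe.degreePart_eq he)
    (fun _ he => hc.degreePart_eq (hme.trans_lt he)) hLc

variable [Finite K]

theorem ncard_leadingParts_focusFamily_le (hc : IsDiffDegree C c B m)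
    (hmin : ∀ L ∈ 𝓛, ∀ e, IsDiffDegree C L B e → m ≤ e) (hme : m ≤ e) :
    (leadingParts (FreeCoord C ι) (focusFamily C 𝓛 B ι) (liftLabels C B c ∅) e).ncard ≤
      (leadingParts C 𝓛 B e \ {degreePart C c e}).ncard :=
  (ncard_le_ncard (leadingParts_focusFamily_subset hc hmin hme) (toFinite _)).trans
    (ncard_image_le (toFinite _))

theorem weight_focusFamily_lt {d : ℕ} (hd : ∀ k, Nat.card (C k) ≤ d) (hc𝓛 : c ∈ 𝓛)
    (hc : IsDiffDegree C c B m) (hmin : ∀ L ∈ 𝓛, ∀ e, IsDiffDegree C L B e → m ≤ e) :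
    weight (FreeCoord C ι) d (focusFamily C 𝓛 B ι) (liftLabels C B c ∅) < weight C d 𝓛 B := by
  have hmd : m ≤ d := by
    obtain ⟨k, rfl⟩ := exists_card_eq_of_degreePart_ne hc.1
    exact hd k
  refine toColex_lt_toColex_of_le_of_lt (m := ⟨m, Nat.lt_succ_of_le hmd⟩) (fun e hme => ?_) ?_
  · exact (ncard_leadingParts_focusFamily_le hc hmin hme.le).trans
      (ncard_le_ncard sdiff_subset (toFinite _))
  · exact (ncard_leadingParts_focusFamily_le hc hmin le_rfl).trans_lt
      (ncard_sdiff_singleton_lt_of_mem ⟨c, ⟨hc𝓛, hc⟩, rfl⟩ (toFinite _))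

end Weight

theorem isRamsey_of_weight_eq (d : ℕ) (w : Colex (Fin (d + 1) → ℕ)) :
    ∀ {K : Type u} {C : K → Type u} [Finite K] [∀ k, Finite (C k)] [∀ k, Nonempty (C k)]
      {𝓛 : Set (Set K)} {B : Set K}, (∀ k, Nat.card (C k) ≤ d) → weight C d 𝓛 B = w →
      IsRamsey C 𝓛 := by
  induction w using WellFoundedLT.induction with
  | ind w ih =>
  rintro K C _ _ _ 𝓛 B hd rfl
  rcases (𝓛 \ {B}).eq_empty_or_nonempty with hempty | hne
  · exact isRamsey_of_subsingleton (subsingleton_singleton.anti (sdiff_eq_empty.1 hempty))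
  obtain ⟨c, hc𝓛, m, hc, hmin⟩ := exists_isDiffDegree_minimal (C := C) hne
  refine isRamsey_of_focusFamily hne fun ι _ => ?_
  exact ih _ (weight_focusFamily_lt hd hc𝓛 hc hmin)
    (fun k => (Finite.card_subtype_le _).trans (hd k.1)) rfl

theorem isRamsey {K : Type u} (C : K → Type u) [Finite K] [∀ k, Finite (C k)]
    [∀ k, Nonempty (C k)] (𝓛 : Set (Set K)) : IsRamsey C 𝓛 := by
  obtain ⟨d, hd⟩ := (finite_range fun k => Nat.card (C k)).bddAbove
  exact isRamsey_of_weight_eq d _ (B := ∅) (fun k => hd (mem_range_self k)) rfl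

end PolyHalesJewett

open PolyHalesJewett in
theorem mainTheorem1_general (D Q κ : Type u) [Fintype D] [DecidableEq D] [Nonempty D] [Fintype Q]
    [DecidableEq Q] [Finite κ] :
    ∃ N : ℕ, 1 ≤ N ∧ ∀ χ : Finset ((D → Fin N) × Q) → κ,
      ∃ (a : Finset ((D → Fin N) × Q)) (γ : Finset (Fin N)),
        γ.Nonempty ∧
        a ∩ (Fintype.piFinset (fun _ => γ) ×ˢ (Finset.univ : Finset Q)) = ∅ ∧
        ∀ L : Finset Q, χ (a ∪ Fintype.piFinset (fun _ => γ) ×ˢ L) = χ a := by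
  classical
  obtain ⟨N, hN, h⟩ := (isRamsey (fun _ : Q => D) Set.univ).exists_fin κ
  refine ⟨N, hN, fun χ => ?_⟩
  let toFinset (A : Set (Point (fun _ : Q => D) (Fin N))) : Finset ((D → Fin N) × Q) :=
    {v | ⟨v.2, v.1⟩ ∈ A}
  obtain ⟨a, γ, hγ, ha⟩ := h fun A => χ (toFinset A)
  have mem_toFinset (A) (v) : v ∈ toFinset A ↔ ⟨v.2, v.1⟩ ∈ A := Finset.mem_filter_univ v
  have mem_piFinset (v : (D → Fin N) × Q) : v.1 ∈ Fintype.piFinset (fun _ => γ.toFinset) ↔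
      (⟨v.2, v.1⟩ : Point (fun _ : Q => D) (Fin N)) ∈ cube _ γ := by
    simp [cube]
  have hunion (L : Finset Q) :
      toFinset (override a γ ∅) ∪ Fintype.piFinset (fun _ => γ.toFinset) ×ˢ L =
        toFinset (override a γ L) := by
    ext v
    simp only [Finset.mem_union, Finset.mem_product, mem_toFinset, mem_piFinset, mem_override,
      Set.mem_empty_iff_false, SetLike.mem_coe]
    tauto
  refine ⟨toFinset (override a γ ∅), γ.toFinset, Set.toFinset_nonempty.2 hγ, ?_, fun L => ?_⟩
  · ext v
    simp only [Finset.mem_inter, Finset.mem_product, mem_toFinset, mem_piFinset, mem_override,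
      Set.mem_empty_iff_false, Finset.notMem_empty]
    tauto
  · rw [hunion]
    exact ha _ (Set.mem_univ _) _ (Set.mem_univ _)

theorem mainTheorem1 (r d q : ℕ) (hr : 1 ≤ r) (hd : 1 ≤ d) (hq : 1 ≤ q) :
    ∃ N : ℕ, 1 ≤ N ∧ ∀ χ : Finset (PHJSpace N d q) → Fin r,
      ∃ (a : Finset (PHJSpace N d q)) (γ : Finset (Fin N)),
        γ.Nonempty ∧
        a ∩ (cartesianPower d γ ×ˢ (Finset.univ : Finset (Fin q))) = ∅ ∧
        ∀ i : Fin q, χ (a ∪ (cartesianPower d γ ×ˢ {i})) = χ a := by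
  have : NeZero d := ⟨by omega⟩
  obtain ⟨N, hN, h⟩ := mainTheorem1_general (Fin d) (Fin q) (Fin r)
  refine ⟨N, hN, fun χ => ?_⟩
  obtain ⟨a, γ, hγ, hdisj, hmono⟩ := h χ
  exact ⟨a, γ, hγ, hdisj, fun i => hmono {i}⟩
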